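/- A locally convex vector lattice is a real vector lattice with a locally convex vector space topology that has a base of neighbourhoods of $0$ consisting of solid sets. A set $A\subset E$ is a generating system of $E$ ($E$ is generated by $A$) if $E$ is the smallest closed vector sublattice of $E$ that contains $A$. For $u\in E^+$ put $E_u=\bigcup_{n\ge 1}\{x\in E: |x|\le n u\}$; $u$ is a quasi-interior point of $E^+$ if $E_u$ is dense in $E$. A lattice homomorphism is a linear map that preserves finite suprema and infima. **Theorem 7.** Let $E$ be a Hausdorff, sequentially complete locally convex vector lattice, $u$ a quasi-interior point of the positive cone $E^+$, and $\{u_i : i\in I\}\subset E_u$ a generating system of $E$. Then: (i) There are a compact Hausdorff space $X$ and a bijective lattice isomorphism (linear, preserving the lattice operations) $T: C(X)\to E_u$ with $T(1_X)=u$, where $C(X)$ is the space of continuous real-valued functions on $X$. (ii) Let $X$ be any compact space and $T: C(X)\to E_u$ any bijective lattice isomorphism with $T(1_X)=u$, and put $u_i^{(2)}:=T\big((T^{-1}u_i)^2\big)$. If $F$ is any locally convex vector lattice, $P:E\to F$ a continuous lattice homomorphism, and $T_n:E\to F$ $(n\in\mathbb N)$ an equicontinuous sequence of positive linear maps with $$T_n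 v\to Pv \text{ in } F\quad\text{for all } v\in\{u\}\cup\{u_i,u_i^{(2)} : i\in I\},$$ then $T_nf\to Pf$ in $F$ for all $f\in E$. (iii) If $E$ is generated by $k$ elements, then there is a set $S\subset E$ with at most $2k+1$ elements such that, for every locally convex vector lattice $F$, every continuous lattice homomorphism $P:E\to F$ and every equicontinuous sequence of positive linear maps $T_n:E\to F$, convergence $T_nv\to Pv$ for all $v\in S$ implies $T_nf\to Pf$ for all $f\in E$. -/

import Mathlib

open Filter Topology

universe u v w t

/-- A (real) locally convex vector lattice: a vector lattice with a locally convex vector space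
topology that has a neighbourhood base of solid sets at `0`. The Hausdorff property is kept
separate, as the class `T2Space`. -/
class LocallyConvexVectorLattice (E : Type u) [AddCommGroup E] [Lattice E] [Module ℝ E]
    [UniformSpace E] : Prop extends IsOrderedAddMonoid E, IsOrderedModule ℝ E,
    IsUniformAddGroup E, ContinuousSMul ℝ E, LocallyConvexSpace ℝ E where
  solid_basis : (𝓝 (0 : E)).HasBasis
    (fun s : Set E => s ∈ 𝓝 (0 : E) ∧ LatticeOrderedAddCommGroup.IsSolid s) id

/-- Every Cauchy sequence converges. -/
def IsSequentiallyComplete (E : Type u) [UniformSpace E] : Prop :=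
  ∀ x : ℕ → E, CauchySeq x → ∃ a : E, Tendsto x atTop (𝓝 a)

/-- The principal ideal `E_e = ⋃ₙ {x : |x| ≤ n e}`, as a linear subspace of `E`. -/
def principalIdeal {E : Type u} [AddCommGroup E] [Lattice E] [IsOrderedAddMonoid E] [Module ℝ E]
    [IsOrderedModule ℝ E] (e : E) : Submodule ℝ E where
  carrier := {x | ∃ n : ℕ, |x| ≤ n • e}
  zero_mem' := ⟨0, by simp⟩
  add_mem' := by
    rintro x y ⟨n, hn⟩ ⟨m, hm⟩
    exact ⟨n + m, (abs_add_le x y).trans (by rw [add_nsmul]; exact add_le_add hn hm)⟩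
  smul_mem' := by
    rintro c x ⟨n, hn⟩
    obtain ⟨m, hm⟩ := exists_nat_ge |c|
    have h1 : |c • x| ≤ |c| • |x| := by
      refine abs_le'.2 ⟨?_, ?_⟩
      · rcases le_total 0 c with hc | hc
        · rw [abs_of_nonneg hc]
          exact smul_le_smul_of_nonneg_left (le_abs_self x) hc
        · rw [abs_of_nonpos hc, ← neg_smul_neg c x]
          exact smul_le_smul_of_nonneg_left (neg_le_abs x) (neg_nonneg.2 hc)
      · rcases le_total 0 c with hc | hc
        · rw [abs_of_nonneg hc, ← smul_neg]
          exact smul_le_smul_of_nonneg_left (neg_le_abs x) hc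
        · rw [abs_of_nonpos hc, ← neg_smul]
          exact smul_le_smul_of_nonneg_left (le_abs_self x) (neg_nonneg.2 hc)
    refine ⟨m * n, h1.trans ?_⟩
    calc |c| • |x| ≤ (m : ℝ) • |x| := smul_le_smul_of_nonneg_right hm (abs_nonneg x)
      _ = m • |x| := Nat.cast_smul_eq_nsmul ℝ m |x|
      _ ≤ m • (n • e) := nsmul_le_nsmul_right hn m
      _ = (m * n) • e := by rw [mul_comm, mul_nsmul]

/-- `e` is a quasi-interior point of the positive cone: `e ≥ 0` and `E_e` is dense in `E`. -/
def IsQuasiInteriorPoint {E : Type u} [AddCommGroup E] [Lattice E] [IsOrderedAddMonoid E]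
    [Module ℝ E] [IsOrderedModule ℝ E] [TopologicalSpace E] (e : E) : Prop :=
  0 ≤ e ∧ Dense (principalIdeal e : Set E)

/-- `A` is a generating system of `E`: the only closed vector sublattice of `E` that
contains `A` is `E` itself. -/
def IsGeneratingSystem {E : Type u} [AddCommGroup E] [Lattice E] [Module ℝ E]
    [TopologicalSpace E] (A : Set E) : Prop :=
  ∀ M : Submodule ℝ E, (∀ x ∈ M, ∀ y ∈ M, x ⊔ y ∈ M ∧ x ⊓ y ∈ M) →
    IsClosed (M : Set E) → A ⊆ M → M = ⊤

/-- A linear map that preserves binary suprema and infima. -/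
def IsVectorLatticeHom {E : Type u} {F : Type w} [AddCommGroup E] [Lattice E] [Module ℝ E]
    [AddCommGroup F] [Lattice F] [Module ℝ F] (P : E →ₗ[ℝ] F) : Prop :=
  ∀ x y : E, P (x ⊔ y) = P x ⊔ P y ∧ P (x ⊓ y) = P x ⊓ P y

/-- The linear bijection `T : C(X) → E_e` is a lattice isomorphism. Since `E_e` is a sublattice
of `E`, its lattice operations are computed in `E`. -/
def IsLatticeIsoOntoIdeal {E : Type u} [AddCommGroup E] [Lattice E] [IsOrderedAddMonoid E]
    [Module ℝ E] [IsOrderedModule ℝ E] {e : E} {X : Type v} [TopologicalSpace X]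
    (T : C(X, ℝ) ≃ₗ[ℝ] principalIdeal e) : Prop :=
  IsVectorLatticeHom ((principalIdeal e).subtype ∘ₗ T.toLinearMap)

/-- `S` is a test set for convergence: if an equicontinuous sequence of positive linear maps from
`E` to a locally convex vector lattice `F` converges on `S` to a continuous lattice homomorphism
`P`, then it converges to `P` on all of `E`. -/
def IsConvergenceTestSet {E : Type u} [AddCommGroup E] [Lattice E] [Module ℝ E]
    [TopologicalSpace E] (S : Set E) : Prop :=
  ∀ (F : Type w) [AddCommGroup F] [Lattice F] [Module ℝ F] [UniformSpace F]
    [LocallyConvexVectorLattice F] (P : E →ₗ[ℝ] F) (Tn : ℕ → E →ₗ[ℝ] F),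
    Continuous P → IsVectorLatticeHom P →
    (∀ n : ℕ, ∀ x : E, 0 ≤ x → 0 ≤ Tn n x) →
    Equicontinuous (fun n : ℕ => (Tn n : E → F)) →
    (∀ x ∈ S, Tendsto (fun n : ℕ => Tn n x) atTop (𝓝 (P x))) →
    ∀ x : E, Tendsto (fun n : ℕ => Tn n x) atTop (𝓝 (P x))

/-!
**Representation.** In `E_e` the element `e` is an Archimedean order unit, and Kakutani's
theorem identifies `E_e` with `C(X)`, where `X` is the compact space of unital real-valued
lattice homomorphisms on `E_e` (`latticeSpectrum`). What has to be shown is that there are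
enough of these. Consider sublinear functionals `p` with `p (x ⊔ y) ≤ max (p x) (p y)`, such as
the gauge `x ↦ inf {c | x ≤ c • e}`. By Zorn's lemma there are minimal ones, and a minimal one
is linear: the functional `x ↦ inf_t (p (x + t • z) - t * p z)` is of the same kind and lies
below `p`, so it equals `p`, and its value at `-z` is at most `-p z`
(`IsMaxSublinear.exists_latticeHom_le`). The lattice form of the Stone–Weierstrass theorem shows
that the image of `E_e` in `C(X)` is dense, and sequential completeness of `E` that it is all of
`C(X)` (`IsArchOrderUnit.latticeGelfand_surjective`, `exists_latticeIso_principalIdeal`).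

**Convergence.** Let `T : C(X) → E_e` be a lattice isomorphism with `T 1 = e`, put `f i = T⁻¹ (a
i)`, `R n = T_n ∘ T`, `Q = P ∘ T`, and let `h ∈ C(X)` be constant on the common fibres of the `f
i`. For every `y` a function `h y + ε + c * ∑ (f i - f i y) ^ 2`, with a finite sum, dominates
`h` and exceeds it by at most `2 * ε` near `y`; by compactness a finite infimum `k₁ ⊓ ⋯ ⊓ k_m`
of such functions lies between `h` and `h + 2 * ε` (`exists_inf_majorant`). The sequence
converges at every `k_j`, and since `R n` is positive and `Q` preserves infima, `R n h ≤ R n k₁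
⊓ ⋯ ⊓ R n k_m`, which tends to `Q (k₁ ⊓ ⋯ ⊓ k_m) ≤ Q h + 2 * ε • Q 1`. The same for `-h` gives
`R n h → Q h` (`tendsto_of_mem_fibreConstant`). The functions `h` in question form a vector
sublattice of `C(X)` whose image under `T` contains all `a i`, so this image is dense in `E`,
and equicontinuity extends the convergence to `E` (`isConvergenceTestSet_of_latticeIso`).

For a finite generating set `A`, without a given quasi-interior point, the same argument applies
with the unit `∑ x ∈ A, |x|` (`exists_finite_isConvergenceTestSet`).
-/

/-! ### Continuity of the lattice operations -/

section LatticeTopology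

variable {E : Type u} [AddCommGroup E] [Lattice E] [Module ℝ E] [UniformSpace E]
  [LocallyConvexVectorLattice E]

/-- Domination in absolute value preserves convergence to `0`, by solidity of the
neighbourhood base. -/
theorem LocallyConvexVectorLattice.tendsto_zero_of_abs_le {α : Type*} {l : Filter α}
    {y z : α → E} (hz : Tendsto z l (𝓝 0)) (h : ∀ i, |y i| ≤ |z i|) : Tendsto y l (𝓝 0) := by
  rw [LocallyConvexVectorLattice.solid_basis.tendsto_right_iff]
  rintro s ⟨hs, hsolid⟩
  filter_upwards [hz hs] with i hi
  exact hsolid hi (h i)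

theorem LocallyConvexVectorLattice.tendsto_abs_zero {α : Type*} {l : Filter α} {z : α → E}
    (hz : Tendsto z l (𝓝 0)) : Tendsto (fun i => |z i|) l (𝓝 0) :=
  tendsto_zero_of_abs_le hz fun i => (abs_abs (z i)).le

theorem LocallyConvexVectorLattice.continuousSup : ContinuousSup E := by
  refine ⟨continuous_iff_continuousAt.2 fun ⟨a, b⟩ => ?_⟩
  have h1 : Tendsto (fun p : E × E => p.1 - a) (𝓝 (a, b)) (𝓝 0) := by
    have : Continuous fun p : E × E => p.1 - a := by fun_prop
    simpa using this.tendsto (a, b)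
  have h2 : Tendsto (fun p : E × E => p.2 - b) (𝓝 (a, b)) (𝓝 0) := by
    have : Continuous fun p : E × E => p.2 - b := by fun_prop
    simpa using this.tendsto (a, b)
  have h3 : Tendsto (fun p : E × E => |p.1 - a| + |p.2 - b|) (𝓝 (a, b)) (𝓝 0) := by
    simpa using (tendsto_abs_zero h1).add (tendsto_abs_zero h2)
  have h4 : Tendsto (fun p : E × E => p.1 ⊔ p.2 - a ⊔ b) (𝓝 (a, b)) (𝓝 0) := by
    refine tendsto_zero_of_abs_le h3 fun p => ?_
    rw [abs_of_nonneg (add_nonneg (abs_nonneg (p.1 - a)) (abs_nonneg _))]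
    calc |p.1 ⊔ p.2 - a ⊔ b| = |(p.1 ⊔ p.2 - a ⊔ p.2) + (a ⊔ p.2 - a ⊔ b)| := by
          rw [sub_add_sub_cancel]
      _ ≤ |p.1 ⊔ p.2 - a ⊔ p.2| + |a ⊔ p.2 - a ⊔ b| := abs_add_le _ _
      _ ≤ _ := by
        refine add_le_add (abs_sup_sub_sup_le_abs _ _ _) ?_
        rw [sup_comm a, sup_comm a]
        exact abs_sup_sub_sup_le_abs _ _ _
  simpa [ContinuousAt] using h4.add_const (a ⊔ b)

theorem LocallyConvexVectorLattice.continuousInf : ContinuousInf E := by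
  have := LocallyConvexVectorLattice.continuousSup (E := E)
  refine ⟨?_⟩
  have h : (fun p : E × E => p.1 ⊓ p.2) = fun p => -(-p.1 ⊔ -p.2) := by
    ext p; rw [neg_sup, neg_neg, neg_neg]
  rw [h]
  fun_prop

theorem LocallyConvexVectorLattice.orderClosedTopology [T2Space E] : OrderClosedTopology E := by
  have := LocallyConvexVectorLattice.continuousSup (E := E)
  refine ⟨?_⟩
  simp only [← sup_eq_right]
  exact isClosed_eq (by fun_prop) (by fun_prop)

/-- A Hausdorff locally convex vector lattice is Archimedean. -/
theorem LocallyConvexVectorLattice.nonpos_of_forall_le_smul [T2Space E] {x e : E}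
    (h : ∀ ε : ℝ, 0 < ε → x ≤ ε • e) : x ≤ 0 := by
  have := LocallyConvexVectorLattice.orderClosedTopology (E := E)
  have h1 : Tendsto (fun n : ℕ => (1 / ((n : ℝ) + 1)) • e) atTop (𝓝 ((0 : ℝ) • e)) :=
    tendsto_one_div_add_atTop_nhds_zero_nat.smul_const e
  rw [zero_smul] at h1
  exact ge_of_tendsto' h1 fun n => h _ (by positivity)

/-- The closure of a vector sublattice is everything as soon as the sublattice contains a
generating system. -/
theorem IsGeneratingSystem.dense {A : Set E} (hA : IsGeneratingSystem A) (M : Submodule ℝ E)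
    (hM : ∀ x ∈ M, ∀ y ∈ M, x ⊔ y ∈ M ∧ x ⊓ y ∈ M) (hAM : A ⊆ M) : Dense (M : Set E) := by
  have := LocallyConvexVectorLattice.continuousSup (E := E)
  have := LocallyConvexVectorLattice.continuousInf (E := E)
  have h := hA M.topologicalClosure (fun x hx y hy => ⟨?_, ?_⟩) M.isClosed_topologicalClosure
    (hAM.trans M.le_topologicalClosure)
  · rw [dense_iff_closure_eq, ← Submodule.topologicalClosure_coe, h, Submodule.top_coe]
  · exact map_mem_closure₂ continuous_sup hx hy fun a ha b hb => (hM a ha b hb).1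
  · exact map_mem_closure₂ continuous_inf hx hy fun a ha b hb => (hM a ha b hb).2

end LatticeTopology

/-! ### The vector lattice `E_e` -/

section Ideal

variable {E : Type u} [AddCommGroup E] [Lattice E] [IsOrderedAddMonoid E] [Module ℝ E]
  [IsOrderedModule ℝ E] {e : E}

theorem principalIdeal.mem_of_abs_le {x y : E} (hy : y ∈ principalIdeal e) (h : |x| ≤ |y|) :
    x ∈ principalIdeal e := by
  obtain ⟨n, hn⟩ := hy
  exact ⟨n, h.trans hn⟩

theorem principalIdeal.abs_mem {x : E} (hx : x ∈ principalIdeal e) : |x| ∈ principalIdeal e :=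
  mem_of_abs_le hx (abs_abs x).le

theorem principalIdeal.sup_mem {x y : E} (hx : x ∈ principalIdeal e) (hy : y ∈ principalIdeal e) :
    x ⊔ y ∈ principalIdeal e := by
  refine mem_of_abs_le (add_mem (abs_mem hx) (abs_mem hy)) ?_
  have h0 := add_nonneg (abs_nonneg x) (abs_nonneg y)
  have h1 : |x| ≤ |x| + |y| := le_add_of_nonneg_right (abs_nonneg y)
  have h2 : |y| ≤ |x| + |y| := le_add_of_nonneg_left (abs_nonneg x)
  rw [abs_of_nonneg h0]
  exact abs_le'.2 ⟨sup_le ((le_abs_self x).trans h1) ((le_abs_self y).trans h2),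
    (neg_le_neg le_sup_left).trans ((neg_le_abs x).trans h1)⟩

theorem principalIdeal.inf_mem {x y : E} (hx : x ∈ principalIdeal e) (hy : y ∈ principalIdeal e) :
    x ⊓ y ∈ principalIdeal e := by
  have h := neg_mem (sup_mem (neg_mem hx) (neg_mem hy))
  rwa [neg_sup, neg_neg, neg_neg] at h

/-- The lattice structure of `E_e`, with the operations of the ambient lattice. -/
instance principalIdeal.instLattice : Lattice (principalIdeal e) :=
  Subtype.lattice (fun _ _ hx hy => sup_mem hx hy) (fun _ _ hx hy => inf_mem hx hy)

theorem principalIdeal.coe_sup (x y : principalIdeal e) :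
    ((x ⊔ y : principalIdeal e) : E) = x ⊔ y := rfl

theorem principalIdeal.coe_inf (x y : principalIdeal e) :
    ((x ⊓ y : principalIdeal e) : E) = x ⊓ y := rfl

theorem principalIdeal.self_mem (he : 0 ≤ e) : e ∈ principalIdeal e :=
  ⟨1, by rw [abs_of_nonneg he, one_nsmul]⟩

instance principalIdeal.instIsOrderedAddMonoid : IsOrderedAddMonoid (principalIdeal e) :=
  Submodule.toIsOrderedAddMonoid _

instance principalIdeal.instIsOrderedModule : IsOrderedModule ℝ (principalIdeal e) where
  smul_le_smul_of_nonneg_left _ hc _ _ h :=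
    smul_le_smul_of_nonneg_left (α := ℝ) (β := E) h hc
  smul_le_smul_of_nonneg_right _ hx _ _ h :=
    smul_le_smul_of_nonneg_right (α := ℝ) (β := E) h hx

end Ideal

/-! ### Real-valued lattice homomorphisms -/

section MaxSublinear

variable {V : Type u} [AddCommGroup V] [Lattice V] [Module ℝ V]

/-- Sublinear functionals `p` with `p (x ⊔ y) ≤ max (p x) (p y)`. On `C(X)`, for `X`
compact Hausdorff, the maxima `f ↦ max_K f` over nonempty closed sets `K ⊆ X` are of this kind, and
the minimal ones among these are the point evaluations. -/
structure IsMaxSublinear (p : V → ℝ) : Prop where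
  add_le : ∀ x y, p (x + y) ≤ p x + p y
  smul_le : ∀ (c : ℝ) (x : V), 0 < c → p (c • x) ≤ c * p x
  sup_le : ∀ x y, p (x ⊔ y) ≤ max (p x) (p y)

namespace IsMaxSublinear

variable {p : V → ℝ}

theorem neg_le (hp : IsMaxSublinear p) (x : V) : -p (-x) ≤ p x := by
  have h0 := hp.add_le 0 0
  have h := hp.add_le x (-x)
  rw [add_zero] at h0
  rw [add_neg_cancel] at h
  linarith

theorem zero_eq (hp : IsMaxSublinear p) : p 0 = 0 := by
  have h1 := hp.add_le 0 0
  have h2 := hp.smul_le (1 / 2) 0 (by norm_num)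
  rw [add_zero] at h1
  rw [smul_zero] at h2
  linarith

theorem smul_eq (hp : IsMaxSublinear p) {c : ℝ} (hc : 0 ≤ c) (x : V) : p (c • x) = c * p x := by
  rcases hc.eq_or_lt with rfl | hc
  · rw [zero_smul, hp.zero_eq, zero_mul]
  · refine le_antisymm (hp.smul_le c x hc) ?_
    have h := hp.smul_le c⁻¹ (c • x) (inv_pos.2 hc)
    rw [smul_smul, inv_mul_cancel₀ hc.ne', one_smul] at h
    calc c * p x ≤ c * (c⁻¹ * p (c • x)) := mul_le_mul_of_nonneg_left h hc.le
      _ = p (c • x) := by field_simp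

/-- If `p` is the maximum over `K`, then `slide p z` is the maximum over the subset of `K` on
which `z` attains its largest value `p z`. -/
noncomputable def slide (p : V → ℝ) (z x : V) : ℝ := ⨅ t : NNReal, (p (x + (t : ℝ) • z) - t * p z)

theorem slide_bddBelow (hp : IsMaxSublinear p) (z x : V) :
    BddBelow (Set.range fun t : NNReal => p (x + (t : ℝ) • z) - t * p z) := by
  refine ⟨-p (-x), ?_⟩
  rintro _ ⟨t, rfl⟩
  have h := hp.add_le (x + (t : ℝ) • z) (-x)
  rw [add_neg_cancel_comm, hp.smul_eq t.coe_nonneg] at h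
  dsimp only
  linarith

theorem slide_le (hp : IsMaxSublinear p) (z x : V) (t : NNReal) :
    slide p z x ≤ p (x + (t : ℝ) • z) - t * p z :=
  ciInf_le (hp.slide_bddBelow z x) t

theorem slide_le_self (hp : IsMaxSublinear p) (z x : V) : slide p z x ≤ p x := by
  simpa using hp.slide_le z x 0

theorem slide_neg_le (hp : IsMaxSublinear p) (z : V) : slide p z (-z) ≤ -p z := by
  simpa [hp.zero_eq] using hp.slide_le z (-z) 1

theorem slide_term_antitone (hp : IsMaxSublinear p) (z x : V) (t s : NNReal) :
    p (x + ((t + s : NNReal) : ℝ) • z) - ((t + s : NNReal) : ℝ) * p z ≤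
      p (x + (t : ℝ) • z) - t * p z := by
  have h := hp.add_le (x + (t : ℝ) • z) ((s : ℝ) • z)
  rw [hp.smul_eq s.coe_nonneg, add_assoc, ← add_smul] at h
  rw [NNReal.coe_add]
  linarith

theorem isMaxSublinear_slide [IsOrderedAddMonoid V] (hp : IsMaxSublinear p) (z : V) :
    IsMaxSublinear (slide p z) where
  add_le x y := by
    refine le_ciInf_add_ciInf fun t s => ?_
    have h := hp.add_le (x + (t : ℝ) • z) (y + (s : ℝ) • z)
    have h2 := hp.slide_le z (x + y) (t + s)
    rw [NNReal.coe_add, add_smul, add_add_add_comm] at h2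
    linarith
  smul_le c x hc := by
    obtain ⟨c, rfl⟩ : ∃ d : NNReal, (d : ℝ) = c := ⟨⟨c, hc.le⟩, rfl⟩
    unfold slide
    rw [Real.mul_iInf_of_nonneg hc.le]
    refine le_ciInf fun t => (hp.slide_le z ((c : ℝ) • x) (c * t)).trans ?_
    have h := hp.smul_le c (x + (t : ℝ) • z) hc
    rw [smul_add, smul_smul] at h
    rw [NNReal.coe_mul]
    linarith
  sup_le x y := by
    by_contra! h
    obtain ⟨h1, h2⟩ := max_lt_iff.1 h
    obtain ⟨t, ht⟩ := exists_lt_of_ciInf_lt h1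
    obtain ⟨s, hs⟩ := exists_lt_of_ciInf_lt h2
    have h3 := (hp.slide_term_antitone z x t s).trans_lt ht
    have h4 := hp.slide_term_antitone z y s t
    rw [add_comm s t] at h4
    have h5 := h4.trans_lt hs
    have h6 := hp.slide_le z (x ⊔ y) (t + s)
    rw [sup_add] at h6
    rcases le_max_iff.1 (hp.sup_le (x + ((t + s : NNReal) : ℝ) • z)
      (y + ((t + s : NNReal) : ℝ) • z)) with h7 | h7 <;> linarith

theorem exists_minimal (hp : IsMaxSublinear p) :
    ∃ q : V → ℝ, q ≤ p ∧ IsMaxSublinear q ∧ ∀ r, IsMaxSublinear r → r ≤ q → q ≤ r := by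
  suffices hchain : ∀ c ⊆ {q : (V → ℝ)ᵒᵈ | IsMaxSublinear (OrderDual.ofDual q)},
      IsChain (· ≤ ·) c → ∀ y ∈ c,
        ∃ ub ∈ {q : (V → ℝ)ᵒᵈ | IsMaxSublinear (OrderDual.ofDual q)}, ∀ z ∈ c, z ≤ ub by
    obtain ⟨m, hpm, hm⟩ := zorn_le_nonempty₀ _ hchain (OrderDual.toDual p) hp
    exact ⟨OrderDual.ofDual m, hpm, hm.1, fun r hr hrm => hm.2 (y := OrderDual.toDual r) hr hrm⟩
  intro c hcs hc y hy
  have hne : Nonempty c := ⟨⟨y, hy⟩⟩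
  have hbdd : ∀ x, BddBelow (Set.range fun q : c => OrderDual.ofDual q.1 x) := by
    intro x
    refine ⟨-OrderDual.ofDual y (-x), ?_⟩
    rintro _ ⟨q, rfl⟩
    rcases hc.total q.2 hy with h | h
    · exact ((hcs hy).neg_le x).trans (h x)
    · exact (neg_le_neg (h (-x))).trans ((hcs q.2).neg_le x)
  have hdir : ∀ q r : c, ∃ s : c, (∀ x, OrderDual.ofDual s.1 x ≤ OrderDual.ofDual q.1 x) ∧
      ∀ x, OrderDual.ofDual s.1 x ≤ OrderDual.ofDual r.1 x := by
    intro q r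
    rcases hc.total q.2 r.2 with h | h
    · exact ⟨r, h, fun x => le_rfl⟩
    · exact ⟨q, fun x => le_rfl, h⟩
  refine ⟨OrderDual.toDual fun x => ⨅ q : c, OrderDual.ofDual q.1 x, ?_,
    fun q hq x => ciInf_le (hbdd x) ⟨q, hq⟩⟩
  constructor
  · intro x y
    refine le_ciInf_add_ciInf fun q r => ?_
    obtain ⟨s, hs1, hs2⟩ := hdir q r
    exact (ciInf_le (hbdd _) s).trans (((hcs s.2).add_le x y).trans (add_le_add (hs1 x) (hs2 y)))
  · intro a x ha
    change (⨅ q : c, OrderDual.ofDual q.1 (a • x)) ≤ a * ⨅ q : c, OrderDual.ofDual q.1 x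
    rw [Real.mul_iInf_of_nonneg ha.le]
    exact le_ciInf fun q => (ciInf_le (hbdd _) q).trans ((hcs q.2).smul_le a x ha)
  · intro x y
    by_contra! h
    obtain ⟨h1, h2⟩ := max_lt_iff.1 h
    obtain ⟨q, hq⟩ := exists_lt_of_ciInf_lt h1
    obtain ⟨r, hr⟩ := exists_lt_of_ciInf_lt h2
    obtain ⟨s, hs1, hs2⟩ := hdir q r
    have h3 : (⨅ q : c, OrderDual.ofDual q.1 (x ⊔ y)) ≤ OrderDual.ofDual s.1 (x ⊔ y) :=
      ciInf_le (hbdd _) s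
    exact lt_irrefl _ ((h3.trans ((hcs s.2).sup_le x y)).trans_lt
      (max_lt ((hs1 x).trans_lt hq) ((hs2 y).trans_lt hr)))

/-- A minimal max-sublinear functional `q` coincides with all its slides, which forces
`q (-z) = -q z`, so it is linear. -/
theorem exists_latticeHom_le [IsOrderedAddMonoid V] (hp : IsMaxSublinear p)
    (hneg : ∀ x ≤ 0, p x ≤ 0) :
    ∃ φ : V →ₗ[ℝ] ℝ, (∀ x, φ x ≤ p x) ∧ ∀ x y, φ (x ⊔ y) = max (φ x) (φ y) := by
  obtain ⟨q, hqp, hq, hmin⟩ := hp.exists_minimal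
  have hodd : ∀ z, q (-z) = -q z := by
    intro z
    refine le_antisymm ?_ (by linarith [hq.neg_le z])
    exact (hmin _ (hq.isMaxSublinear_slide z) (hq.slide_le_self z) (-z)).trans (hq.slide_neg_le z)
  have hadd : ∀ x y, q (x + y) = q x + q y := by
    intro x y
    refine le_antisymm (hq.add_le x y) ?_
    have h := hq.add_le (-x) (-y)
    rw [← neg_add, hodd, hodd, hodd] at h
    linarith
  let φ : V →ₗ[ℝ] ℝ :=
    { toFun := q
      map_add' := hadd
      map_smul' := by
        intro c x
        rw [RingHom.id_apply, smul_eq_mul]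
        rcases le_total 0 c with hc | hc
        · exact hq.smul_eq hc x
        · have h := hq.smul_eq (neg_nonneg.2 hc) x
          rw [neg_smul, hodd] at h
          linarith }
  have hmono : ∀ x y, x ≤ y → φ x ≤ φ y := by
    intro x y hxy
    have h : φ (x - y) ≤ 0 := (hqp _).trans (hneg _ (sub_nonpos.2 hxy))
    rw [map_sub] at h
    linarith
  exact ⟨φ, hqp, fun x y => le_antisymm (hq.sup_le x y)
    (max_le (hmono _ _ le_sup_left) (hmono _ _ le_sup_right))⟩

end IsMaxSublinear

end MaxSublinear

section OrderUnit

variable {V : Type u} [AddCommGroup V] [Lattice V] [Module ℝ V]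

/-- `e ≥ 0` is an Archimedean order unit: every element is dominated by a multiple of `e`, and
an element below all `ε • e` with `ε > 0` is nonpositive. -/
structure IsArchOrderUnit (e : V) : Prop where
  nonneg : 0 ≤ e
  exists_abs_le : ∀ x : V, ∃ n : ℕ, |x| ≤ n • e
  nonpos : ∀ x : V, (∀ ε : ℝ, 0 < ε → x ≤ ε • e) → x ≤ 0

/-- The least `c` with `x ≤ c • e`; on `C(X)` with `e = 1`, the maximum of `x`. -/
noncomputable def upperGauge (e x : V) : ℝ := sInf {c : ℝ | x ≤ c • e}

theorem IsArchOrderUnit.exists_abs_le_smul {e : V} (he : IsArchOrderUnit e) (x : V) :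
    ∃ c : ℝ, 0 ≤ c ∧ |x| ≤ c • e := by
  obtain ⟨n, hn⟩ := he.exists_abs_le x
  exact ⟨n, n.cast_nonneg, by rwa [Nat.cast_smul_eq_nsmul]⟩

variable [IsOrderedAddMonoid V] [IsOrderedModule ℝ V] {e : V}

/-- The hypothesis `e ≠ 0` keeps the infimum away from the junk value of `sInf`. -/
theorem IsArchOrderUnit.upperGauge_le_iff (he : IsArchOrderUnit e) (h0 : e ≠ 0) {x : V} {c : ℝ} :
    upperGauge e x ≤ c ↔ x ≤ c • e := by
  obtain ⟨b, -, hb⟩ := he.exists_abs_le_smul x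
  have hne : {c : ℝ | x ≤ c • e}.Nonempty := ⟨b, (le_abs_self x).trans hb⟩
  have hbdd : BddBelow {c : ℝ | x ≤ c • e} := by
    refine ⟨-b, fun c hc => ?_⟩
    by_contra! hlt
    have h1 : 0 ≤ (c + b) • e := by
      rw [add_smul]
      exact neg_le_iff_add_nonneg.1
        ((neg_le_neg hb).trans ((neg_le.1 (neg_le_abs x)).trans hc))
    have h2 : 0 ≤ -(c + b) := by linarith
    have h3 : (c + b) • e ≤ 0 := by
      rw [← neg_nonneg, ← neg_smul]
      exact smul_nonneg h2 he.nonneg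
    exact (smul_eq_zero.1 (le_antisymm h3 h1)).elim (fun h => by linarith) h0
  refine ⟨fun h => ?_, fun h => csInf_le hbdd h⟩
  rw [← sub_nonpos]
  refine he.nonpos _ fun ε hε => ?_
  obtain ⟨d, hd, hdε⟩ := exists_lt_of_csInf_lt hne (h.trans_lt (lt_add_of_pos_right c hε))
  rw [sub_le_iff_le_add, ← add_smul, add_comm ε]
  exact (show x ≤ d • e from hd).trans (smul_le_smul_of_nonneg_right hdε.le he.nonneg)

theorem IsArchOrderUnit.isMaxSublinear_upperGauge (he : IsArchOrderUnit e) (h0 : e ≠ 0) :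
    IsMaxSublinear (upperGauge e) := by
  have hle : ∀ x, x ≤ upperGauge e x • e := fun x => (he.upperGauge_le_iff h0).1 le_rfl
  refine ⟨fun x y => ?_, fun c x hc => ?_, fun x y => ?_⟩
  · rw [he.upperGauge_le_iff h0, add_smul]
    exact add_le_add (hle x) (hle y)
  · rw [he.upperGauge_le_iff h0, mul_smul]
    exact smul_le_smul_of_nonneg_left (hle x) hc.le
  · rw [he.upperGauge_le_iff h0]
    exact sup_le ((hle x).trans (smul_le_smul_of_nonneg_right (le_max_left _ _) he.nonneg))
      ((hle y).trans (smul_le_smul_of_nonneg_right (le_max_right _ _) he.nonneg))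

/-- Unital real lattice homomorphisms detect the relation `x ≤ c • e`. -/
theorem IsArchOrderUnit.exists_latticeHom_lt (he : IsArchOrderUnit e) {x : V} {c : ℝ}
    (h : ¬ x ≤ c • e) :
    ∃ φ : V →ₗ[ℝ] ℝ, (∀ x y, φ (x ⊔ y) = max (φ x) (φ y)) ∧ φ e = 1 ∧ c < φ x := by
  have h0 : e ≠ 0 := by
    rintro rfl
    obtain ⟨n, hn⟩ := he.exists_abs_le x
    rw [smul_zero] at h hn
    exact h ((le_abs_self x).trans hn)
  have hp := he.isMaxSublinear_upperGauge h0
  -- Sliding along `x` forces the homomorphism to take the value `upperGauge e x` at `x`.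
  obtain ⟨φ, hφ, hsup⟩ := (hp.isMaxSublinear_slide x).exists_latticeHom_le fun y hy =>
    (hp.slide_le_self x y).trans ((he.upperGauge_le_iff h0).2 (by rwa [zero_smul]))
  have hle : ∀ y, φ y ≤ upperGauge e y := fun y => (hφ y).trans (hp.slide_le_self x y)
  refine ⟨φ, hsup, le_antisymm ?_ ?_, ?_⟩
  · exact (hle e).trans ((he.upperGauge_le_iff h0).2 (one_smul ℝ e).ge)
  · have h1 := (hle (-e)).trans ((he.upperGauge_le_iff h0 (c := -1)).2 (by rw [neg_one_smul]))
    rw [map_neg] at h1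
    linarith
  · have h1 := (hφ (-x)).trans (hp.slide_neg_le x)
    rw [map_neg] at h1
    rw [← he.upperGauge_le_iff h0, not_le] at h
    linarith

end OrderUnit

/-! ### Kakutani's representation theorem -/

section Kakutani

variable {V : Type u} [AddCommGroup V] [Lattice V] [Module ℝ V]

/-- The unital real-valued lattice homomorphisms, with the topology of pointwise convergence. -/
def latticeSpectrum (e : V) : Set (V → ℝ) :=
  {φ | (∀ x y, φ (x + y) = φ x + φ y) ∧ (∀ (c : ℝ) x, φ (c • x) = c * φ x) ∧
    (∀ x y, φ (x ⊔ y) = max (φ x) (φ y)) ∧ φ e = 1}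

theorem isClosed_latticeSpectrum (e : V) : IsClosed (latticeSpectrum e) := by
  simp only [latticeSpectrum, Set.ofPred_and, Set.ofPred_forall]
  refine IsClosed.inter ?_ (IsClosed.inter ?_ (IsClosed.inter ?_ ?_))
  · exact isClosed_iInter fun x => isClosed_iInter fun y => isClosed_eq (by fun_prop) (by fun_prop)
  · exact isClosed_iInter fun x => isClosed_iInter fun y => isClosed_eq (by fun_prop) (by fun_prop)
  · exact isClosed_iInter fun x => isClosed_iInter fun y => isClosed_eq (by fun_prop) (by fun_prop)
  · exact isClosed_eq (by fun_prop) (by fun_prop)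

/-- Evaluation `x ↦ (φ ↦ φ x)`. -/
def latticeGelfand (e : V) : V →ₗ[ℝ] C(latticeSpectrum e, ℝ) where
  toFun x := ⟨fun φ => φ.1 x, (continuous_apply x).comp continuous_subtype_val⟩
  map_add' x y := by ext φ; exact φ.2.1 x y
  map_smul' c x := by ext φ; exact φ.2.2.1 c x

@[simp] theorem latticeGelfand_apply {e : V} (x : V) (φ : latticeSpectrum e) :
    latticeGelfand e x φ = φ.1 x := rfl

theorem latticeGelfand_unit (e : V) : latticeGelfand e e = 1 := by
  ext φ; exact φ.2.2.2.2

theorem latticeGelfand_sup (e x y : V) :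
    latticeGelfand e (x ⊔ y) = latticeGelfand e x ⊔ latticeGelfand e y := by
  ext φ; exact φ.2.2.2.1 x y

theorem latticeGelfand_inf [IsOrderedAddMonoid V] (e x y : V) :
    latticeGelfand e (x ⊓ y) = latticeGelfand e x ⊓ latticeGelfand e y := by
  have h := latticeGelfand_sup e (-x) (-y)
  rw [← neg_inf, map_neg, map_neg, map_neg, ← neg_inf] at h
  exact neg_injective h

theorem latticeGelfand_abs (e x : V) : latticeGelfand e |x| = |latticeGelfand e x| := by
  rw [abs, abs, latticeGelfand_sup, map_neg]

variable [IsOrderedAddMonoid V] [IsOrderedModule ℝ V] {e : V}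

/-- The evaluation map is an order embedding with respect to the multiples of the unit. -/
theorem IsArchOrderUnit.latticeGelfand_le_iff (he : IsArchOrderUnit e) {x : V} {c : ℝ} :
    (∀ φ, latticeGelfand e x φ ≤ c) ↔ x ≤ c • e := by
  refine ⟨fun h => ?_, fun h φ => ?_⟩
  · by_contra hx
    obtain ⟨φ, h1, h2, h3⟩ := he.exists_latticeHom_lt hx
    have h4 : φ x ≤ c := h ⟨φ, φ.map_add, φ.map_smul, h1, h2⟩
    linarith
  · have h1 : φ.1 (x ⊔ c • e) = max (φ.1 x) (φ.1 (c • e)) := φ.2.2.2.1 _ _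
    rw [sup_eq_right.2 h, φ.2.2.1, φ.2.2.2.2, mul_one] at h1
    exact h1.symm ▸ le_max_left _ _

theorem IsArchOrderUnit.abs_latticeGelfand_le_iff (he : IsArchOrderUnit e) {x : V} {c : ℝ} :
    (∀ φ, |latticeGelfand e x φ| ≤ c) ↔ |x| ≤ c • e := by
  rw [← he.latticeGelfand_le_iff, latticeGelfand_abs]
  rfl

theorem IsArchOrderUnit.compactSpace_latticeSpectrum (he : IsArchOrderUnit e) :
    CompactSpace (latticeSpectrum e) := by
  choose b hb0 hb using he.exists_abs_le_smul
  refine isCompact_iff_compactSpace.1 ((isCompact_univ_pi fun x : V =>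
    isCompact_Icc (a := -b x) (b := b x)).of_isClosed_subset (isClosed_latticeSpectrum e) ?_)
  intro φ hφ x _
  exact abs_le.1 (he.abs_latticeGelfand_le_iff.2 (hb x) ⟨φ, hφ⟩)

theorem IsArchOrderUnit.latticeGelfand_injective (he : IsArchOrderUnit e) :
    Function.Injective (latticeGelfand e) := by
  rw [injective_iff_map_eq_zero]
  intro x hx
  have h : |x| ≤ (0 : ℝ) • e := he.abs_latticeGelfand_le_iff.1 fun φ => by simp [hx]
  rw [zero_smul] at h
  exact le_antisymm ((le_abs_self x).trans h) (neg_nonpos.1 ((neg_le_abs x).trans h))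

/-- By the lattice form of the Stone–Weierstrass theorem the evaluation map has dense range, and
completeness of `V` for the norm with unit ball `[-e, e]` makes the range closed. -/
theorem IsArchOrderUnit.latticeGelfand_surjective (he : IsArchOrderUnit e)
    (hcomplete : ∀ s : ℕ → V,
      (∀ ε : ℝ, 0 < ε → ∃ N, ∀ m ≥ N, ∀ n ≥ N, |s m - s n| ≤ ε • e) →
      ∃ x, ∀ ε : ℝ, 0 < ε → ∃ N, ∀ n ≥ N, |s n - x| ≤ ε • e) :
    Function.Surjective (latticeGelfand e) := by
  have := he.compactSpace_latticeSpectrum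
  have hdense : closure (Set.range (latticeGelfand e)) = ⊤ := by
    refine ContinuousMap.sublattice_closure_eq_top _ ⟨_, 0, rfl⟩ ?_ ?_ ?_
    · rintro _ ⟨x, rfl⟩ _ ⟨y, rfl⟩
      exact ⟨x ⊓ y, latticeGelfand_inf e x y⟩
    · rintro _ ⟨x, rfl⟩ _ ⟨y, rfl⟩
      exact ⟨x ⊔ y, latticeGelfand_sup e x y⟩
    · intro v φ ψ
      by_cases h : φ = ψ
      · subst h
        refine ⟨_, ⟨v φ • e, rfl⟩, ?_, ?_⟩ <;> simp [map_smul, latticeGelfand_unit]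
      · obtain ⟨z, hz⟩ := Function.ne_iff.1 fun h' => h (Subtype.ext h')
        have hz' := sub_ne_zero.2 hz
        -- Interpolation at the two points by `a • z + b • e`.
        refine ⟨_, ⟨((v φ - v ψ) / (φ.1 z - ψ.1 z)) • z +
          (v φ - (v φ - v ψ) / (φ.1 z - ψ.1 z) * φ.1 z) • e, rfl⟩, ?_, ?_⟩
        · simp [map_smul, latticeGelfand_unit]
        · simp only [map_add, map_smul, latticeGelfand_unit, ContinuousMap.add_apply,
            ContinuousMap.smul_apply, latticeGelfand_apply, ContinuousMap.one_apply, smul_eq_mul]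
          field_simp
          ring
  intro f
  have hf : f ∈ closure (Set.range (latticeGelfand e)) := hdense ▸ Set.mem_univ f
  obtain ⟨g, hg, hgf⟩ := mem_closure_iff_seq_limit.1 hf
  choose s hs using hg
  obtain ⟨x, hx⟩ := hcomplete s fun ε hε => by
    obtain ⟨N, hN⟩ := Metric.cauchySeq_iff.1 hgf.cauchySeq ε hε
    refine ⟨N, fun m hm n hn => he.abs_latticeGelfand_le_iff.1 fun φ => ?_⟩
    rw [map_sub, hs, hs]
    have h := ContinuousMap.dist_apply_le_dist (f := g m) (g := g n) φ
    rw [Real.dist_eq] at h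
    exact h.trans (hN m hm n hn).le
  refine ⟨x, tendsto_nhds_unique (Metric.tendsto_atTop.2 fun ε hε => ?_) hgf⟩
  obtain ⟨N, hN⟩ := hx (ε / 2) (half_pos hε)
  refine ⟨N, fun n hn => lt_of_le_of_lt ?_ (half_lt_self hε)⟩
  rw [ContinuousMap.dist_le (half_pos hε).le]
  intro φ
  have h := he.abs_latticeGelfand_le_iff.2 (hN n hn) φ
  rw [map_sub, hs] at h
  rwa [Real.dist_eq]

end Kakutani

section Representation

variable {E : Type u} [AddCommGroup E] [Lattice E] [Module ℝ E] [UniformSpace E]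
  [LocallyConvexVectorLattice E]

/-- The unit `e` of `E_e`. -/
def principalIdeal.unit {e : E} (he : 0 ≤ e) : principalIdeal e := ⟨e, self_mem he⟩

theorem principalIdeal.isArchOrderUnit [T2Space E] {e : E} (he : 0 ≤ e) :
    IsArchOrderUnit (unit he) where
  nonneg := he
  exists_abs_le x := x.2
  nonpos x h := LocallyConvexVectorLattice.nonpos_of_forall_le_smul (x := (x : E)) (e := e) h

/-- The order interval `[-ε • e, ε • e]` is eventually contained in every neighbourhood of `0`, so
sequential completeness of `E` gives limits in `E`; they lie in `E_e` because the order is closed,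
and for the same reason the convergence is uniform with respect to `e`. -/
theorem principalIdeal.exists_unitNorm_limit [T2Space E] (hE : IsSequentiallyComplete E)
    {e : E} (he : 0 ≤ e) (s : ℕ → principalIdeal e)
    (hs : ∀ ε : ℝ, 0 < ε → ∃ N, ∀ m ≥ N, ∀ n ≥ N, |s m - s n| ≤ ε • unit he) :
    ∃ x, ∀ ε : ℝ, 0 < ε → ∃ N, ∀ n ≥ N, |s n - x| ≤ ε • unit he := by
  have := LocallyConvexVectorLattice.continuousSup (E := E)
  have := LocallyConvexVectorLattice.orderClosedTopology (E := E)
  have hs' : ∀ ε : ℝ, 0 < ε → ∃ N, ∀ m ≥ N, ∀ n ≥ N, |(s m : E) - s n| ≤ ε • e := hs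
  have hcauchy : CauchySeq fun n => (s n : E) := by
    rw [cauchySeq_iff_tendsto, uniformity_eq_comap_nhds_zero, tendsto_comap_iff,
      LocallyConvexVectorLattice.solid_basis.tendsto_right_iff]
    rintro U ⟨hU, hsolid⟩
    have h1 : Tendsto (fun ε : ℝ => ε • e) (𝓝[>] 0) (𝓝 0) := by
      have h2 : Continuous fun ε : ℝ => ε • e := by fun_prop
      simpa using (h2.tendsto 0).mono_left nhdsWithin_le_nhds
    obtain ⟨ε, hεU, hε⟩ := ((h1.eventually hU).and self_mem_nhdsWithin).exists
    obtain ⟨N, hN⟩ := hs' ε hε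
    filter_upwards [eventually_ge_atTop (N, N)] with p hp
    refine hsolid hεU ?_
    rw [abs_of_nonneg (smul_nonneg (le_of_lt hε) he)]
    exact hN p.2 hp.2 p.1 hp.1
  obtain ⟨a, ha⟩ := hE _ hcauchy
  have hlim : ∀ ε : ℝ, 0 < ε → ∃ N, ∀ n ≥ N, |(s n : E) - a| ≤ ε • e := by
    intro ε hε
    obtain ⟨N, hN⟩ := hs' ε hε
    refine ⟨N, fun n hn => ?_⟩
    have h1 : Tendsto (fun m => |(s n : E) - s m|) atTop (𝓝 |(s n : E) - a|) := by
      have h2 : Continuous fun y : E => |(s n : E) - y| := by unfold abs; fun_prop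
      exact (h2.tendsto a).comp ha
    refine le_of_tendsto h1 ?_
    filter_upwards [eventually_ge_atTop N] with m hm
    exact hN n hn m hm
  have hmem : a ∈ principalIdeal e := by
    obtain ⟨N, hN⟩ := hlim 1 one_pos
    have h1 : (s N : E) - a ∈ principalIdeal e :=
      ⟨1, by simpa using hN N le_rfl⟩
    simpa using sub_mem (s N).2 h1
  exact ⟨⟨a, hmem⟩, hlim⟩

/-- **Kakutani's theorem** for the principal ideals of a sequentially complete locally convex
vector lattice. -/
theorem exists_latticeIso_principalIdeal [T2Space E] (hE : IsSequentiallyComplete E)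
    {e : E} (he : 0 ≤ e) :
    ∃ (X : Type u) (_ : TopologicalSpace X) (_ : CompactSpace X) (_ : T2Space X)
      (T : C(X, ℝ) ≃ₗ[ℝ] principalIdeal e),
      IsLatticeIsoOntoIdeal T ∧ (T 1 : E) = e := by
  have hunit := principalIdeal.isArchOrderUnit he
  let J := LinearEquiv.ofBijective (latticeGelfand (principalIdeal.unit he))
    ⟨hunit.latticeGelfand_injective,
      hunit.latticeGelfand_surjective (principalIdeal.exists_unitNorm_limit hE he)⟩
  refine ⟨latticeSpectrum (principalIdeal.unit he), inferInstance,
    hunit.compactSpace_latticeSpectrum, inferInstance, J.symm, fun f g => ?_, ?_⟩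
  · obtain ⟨x, rfl⟩ := J.surjective f
    obtain ⟨y, rfl⟩ := J.surjective g
    have hsup : J x ⊔ J y = J (x ⊔ y) := (latticeGelfand_sup _ x y).symm
    have hinf : J x ⊓ J y = J (x ⊓ y) := (latticeGelfand_inf _ x y).symm
    rw [hsup, hinf]
    simp only [LinearMap.comp_apply, LinearEquiv.coe_coe, LinearEquiv.symm_apply_apply,
      Submodule.subtype_apply]
    exact ⟨principalIdeal.coe_sup x y, principalIdeal.coe_inf x y⟩
  · have h1 : J.symm 1 = principalIdeal.unit he :=
      J.symm_apply_eq.2 (latticeGelfand_unit _).symm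
    rw [h1]
    rfl

end Representation

/-! ### Approximation from above on a compact space -/

section Envelope

variable {X : Type v} [TopologicalSpace X] {ι : Type t}

/-- The continuous functions that are constant on the common fibres of the family `f`. -/
def fibreConstant (f : ι → C(X, ℝ)) : Submodule ℝ C(X, ℝ) where
  carrier := {h | ∀ x y, (∀ i, f i x = f i y) → h x = h y}
  zero_mem' _ _ _ := rfl
  add_mem' hg hh x y hxy := congrArg₂ (· + ·) (hg x y hxy) (hh x y hxy)
  smul_mem' c _ hh x y hxy := congrArg (c * ·) (hh x y hxy)

variable [CompactSpace X]

/-- The squared distance to the fibre through `y`, measured by finitely many of the `f i`, is a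
combination of `1`, `f i` and `(f i) ^ 2`. A multiple of it dominates `h - h y - ε`, because
finitely many `i` suffice to separate `y` from the compact set `{h ≥ h y + ε}`. -/
theorem exists_quadratic_majorant {f : ι → C(X, ℝ)} {h : C(X, ℝ)} (hh : h ∈ fibreConstant f)
    (D : Submodule ℝ C(X, ℝ)) (h1 : 1 ∈ D) (hf : ∀ i, f i ∈ D) (hf2 : ∀ i, f i ^ 2 ∈ D)
    {ε : ℝ} (hε : 0 < ε) (y : X) : ∃ k ∈ D, h ≤ k ∧ k y = h y + ε := by
  have hK : IsCompact {x | h y + ε ≤ h x} :=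
    (isClosed_le continuous_const h.continuous).isCompact
  obtain ⟨J, hJ⟩ := hK.elim_finite_subcover (fun i => {x | f i x ≠ f i y})
    (fun i => isOpen_ne_fun (f i).continuous continuous_const) (fun x hx => by
      by_contra hcon
      simp only [Set.mem_iUnion, Set.mem_ofPred_eq, not_exists, not_not] at hcon
      have h2 : h x = h y := hh x y hcon
      have h3 : h y + ε ≤ h x := hx
      linarith)
  let q : C(X, ℝ) := ∑ i ∈ J, (f i ^ 2 - (2 * f i y) • f i + (f i y ^ 2) • 1)
  have hq : ∀ x, q x = ∑ i ∈ J, (f i x - f i y) ^ 2 := by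
    intro x
    simp only [q, ContinuousMap.sum_apply]
    refine Finset.sum_congr rfl fun i _ => ?_
    simp only [ContinuousMap.add_apply, ContinuousMap.sub_apply, ContinuousMap.smul_apply,
      ContinuousMap.pow_apply, ContinuousMap.one_apply, smul_eq_mul]
    ring
  have hqD : q ∈ D := D.sum_mem fun i _ =>
    D.add_mem (D.sub_mem (hf2 i) (D.smul_mem _ (hf i))) (D.smul_mem _ h1)
  have hq0 : ∀ x, 0 ≤ q x := fun x => by
    rw [hq]; exact Finset.sum_nonneg fun i _ => sq_nonneg _
  have hqpos : ∀ x ∈ {x | h y + ε ≤ h x}, 0 < q x := by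
    intro x hx
    obtain ⟨i, hi, hix⟩ := Set.mem_iUnion₂.1 (hJ hx)
    rw [hq]
    exact Finset.sum_pos' (fun i _ => sq_nonneg _) ⟨i, hi, sq_pos_of_ne_zero (sub_ne_zero.2 hix)⟩
  obtain ⟨c, hc0, hc⟩ : ∃ c : ℝ, 0 ≤ c ∧ ∀ x, h y + ε ≤ h x → h x - h y ≤ c * q x := by
    rcases Set.eq_empty_or_nonempty {x | h y + ε ≤ h x} with hemp | hne
    · exact ⟨0, le_rfl, fun x hx => absurd (show x ∈ {x | h y + ε ≤ h x} from hx)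
        (hemp ▸ Set.notMem_empty x)⟩
    · obtain ⟨x₀, hx₀, hmin⟩ := hK.exists_isMinOn hne q.continuous.continuousOn
      refine ⟨2 * ‖h‖ / q x₀, div_nonneg (by positivity) (hq0 x₀), fun x hx => ?_⟩
      have h2 : q x₀ ≤ q x := hmin hx
      have h3 := hqpos x₀ hx₀
      calc h x - h y ≤ 2 * ‖h‖ := by
            linarith [(abs_le.1 (h.norm_coe_le_norm x)).2, (abs_le.1 (h.norm_coe_le_norm y)).1]
        _ = 2 * ‖h‖ / q x₀ * q x₀ := by field_simp
        _ ≤ 2 * ‖h‖ / q x₀ * q x :=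
            mul_le_mul_of_nonneg_left h2 (div_nonneg (by positivity) h3.le)
  refine ⟨(h y + ε) • 1 + c • q, D.add_mem (D.smul_mem _ h1) (D.smul_mem _ hqD), fun x => ?_, ?_⟩
  · change h x ≤ (h y + ε) * 1 + c * q x
    rcases le_total (h y + ε) (h x) with hx | hx
    · linarith [hc x hx]
    · linarith [mul_nonneg hc0 (hq0 x)]
  · have h2 : q y = 0 := by rw [hq]; simp
    simp [h2]

/-- A function that is constant on the common fibres of the `f i` is a uniform limit from above of
finite infima of functions in the span of `1`, `f i` and `(f i) ^ 2`. -/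
theorem exists_inf_majorant {f : ι → C(X, ℝ)} {h : C(X, ℝ)} (hh : h ∈ fibreConstant f)
    (D : Submodule ℝ C(X, ℝ)) (h1 : 1 ∈ D) (hf : ∀ i, f i ∈ D) (hf2 : ∀ i, f i ^ 2 ∈ D)
    (G : Set C(X, ℝ)) (hDG : ∀ g ∈ D, g ∈ G) (hG : ∀ g ∈ G, ∀ g' ∈ G, g ⊓ g' ∈ G)
    {ε : ℝ} (hε : 0 < ε) : ∃ g ∈ G, h ≤ g ∧ g ≤ h + ε • 1 := by
  suffices H : ∃ g ∈ G, h ≤ g ∧ ∀ x ∈ Set.univ, g x ≤ h x + ε by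
    obtain ⟨g, hg, hhg, hgh⟩ := H
    exact ⟨g, hg, hhg, fun x => by simpa using hgh x (Set.mem_univ x)⟩
  refine isCompact_univ.induction_on (p := fun s => ∃ g ∈ G, h ≤ g ∧ ∀ x ∈ s, g x ≤ h x + ε)
    ?_ ?_ ?_ ?_
  · refine ⟨‖h‖ • 1, hDG _ (D.smul_mem _ h1), fun x => ?_, fun x hx => hx.elim⟩
    simpa using (abs_le.1 (h.norm_coe_le_norm x)).2
  · rintro s t hst ⟨g, hg, hhg, hgh⟩
    exact ⟨g, hg, hhg, fun x hx => hgh x (hst hx)⟩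
  · rintro s t ⟨g, hg, hhg, hgh⟩ ⟨g', hg', hhg', hgh'⟩
    refine ⟨g ⊓ g', hG g hg g' hg', le_inf hhg hhg', fun x hx => ?_⟩
    rcases hx with hx | hx
    · exact (inf_le_left : g x ⊓ g' x ≤ g x).trans (hgh x hx)
    · exact (inf_le_right : g x ⊓ g' x ≤ g' x).trans (hgh' x hx)
  · intro y _
    obtain ⟨k, hk, hhk, hky⟩ := exists_quadratic_majorant hh D h1 hf hf2 (half_pos hε) y
    refine ⟨{x | k x < h x + ε}, mem_nhdsWithin_of_mem_nhds
      ((isOpen_lt k.continuous (by fun_prop)).mem_nhds ?_), k, hDG k hk, hhk,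
      fun x hx => le_of_lt hx⟩
    change k y < h y + ε
    linarith

end Envelope

/-! ### Korovkin's theorem for lattice homomorphisms -/

section Korovkin

theorem IsVectorLatticeHom.nonneg {V : Type*} [AddCommGroup V] [Lattice V] [Module ℝ V]
    {W : Type*} [AddCommGroup W] [Lattice W] [Module ℝ W] {Q : V →ₗ[ℝ] W}
    (hQ : IsVectorLatticeHom Q) (x : V) (hx : 0 ≤ x) : 0 ≤ Q x := by
  have h := (hQ x 0).1
  rw [sup_eq_left.2 hx, map_zero] at h
  exact h ▸ le_sup_right

variable {X : Type v} [TopologicalSpace X] [CompactSpace X] {ι : Type t}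
  {F : Type w} [AddCommGroup F] [Lattice F] [Module ℝ F] [UniformSpace F]
  [LocallyConvexVectorLattice F]

/-- The subspace on which a sequence of linear maps converges to `Q`. -/
def convergenceSubmodule {V : Type*} [AddCommGroup V] [Module ℝ V] (R : ℕ → V →ₗ[ℝ] F)
    (Q : V →ₗ[ℝ] F) : Submodule ℝ V where
  carrier := {x | Tendsto (fun n => R n x) atTop (𝓝 (Q x))}
  zero_mem' := by simpa using tendsto_const_nhds
  add_mem' {x y} hx hy := by
    simpa using Tendsto.add (show Tendsto (fun n => R n x) atTop (𝓝 (Q x)) from hx) hy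
  smul_mem' c x hx := by
    simpa using Tendsto.const_smul (show Tendsto (fun n => R n x) atTop (𝓝 (Q x)) from hx) c

theorem mem_convergenceSubmodule {V : Type*} [AddCommGroup V] [Module ℝ V]
    {R : ℕ → V →ₗ[ℝ] F} {Q : V →ₗ[ℝ] F} {x : V} :
    x ∈ convergenceSubmodule R Q ↔ Tendsto (fun n => R n x) atTop (𝓝 (Q x)) := Iff.rfl

/-- The elements `x` with `limsup R n x ≤ Q x`, in the sense of an error term that tends to `0`. -/
def asymptoticallyBelow {V : Type*} [AddCommGroup V] [Module ℝ V] (R : ℕ → V →ₗ[ℝ] F)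
    (Q : V →ₗ[ℝ] F) : Set V :=
  {x | ∃ z : ℕ → F, Tendsto z atTop (𝓝 0) ∧ ∀ n, R n x ≤ Q x + z n}

theorem convergenceSubmodule_subset_asymptoticallyBelow {V : Type*} [AddCommGroup V] [Module ℝ V]
    (R : ℕ → V →ₗ[ℝ] F) (Q : V →ₗ[ℝ] F) :
    ∀ x ∈ convergenceSubmodule R Q, x ∈ asymptoticallyBelow R Q := by
  intro x hx
  refine ⟨fun n => R n x - Q x, ?_, fun n => by rw [add_sub_cancel]⟩
  simpa using Tendsto.sub_const (mem_convergenceSubmodule.1 hx) (Q x)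

/-- Here it matters that `Q` preserves infima, whereas the `R n` are merely positive. -/
theorem asymptoticallyBelow_inf_mem {V : Type*} [AddCommGroup V] [Lattice V]
    [IsOrderedAddMonoid V] [Module ℝ V]
    {R : ℕ → V →ₗ[ℝ] F} {Q : V →ₗ[ℝ] F} (hR : ∀ n x, 0 ≤ x → 0 ≤ R n x)
    (hQ : IsVectorLatticeHom Q) {x y : V} (hx : x ∈ asymptoticallyBelow R Q)
    (hy : y ∈ asymptoticallyBelow R Q) : x ⊓ y ∈ asymptoticallyBelow R Q := by
  have hmono : ∀ n x y, x ≤ y → R n x ≤ R n y := fun n x y hxy => by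
    have h := hR n _ (sub_nonneg.2 hxy)
    rwa [map_sub, sub_nonneg] at h
  obtain ⟨z, hz, hxz⟩ := hx
  obtain ⟨z', hz', hyz⟩ := hy
  refine ⟨fun n => |z n| + |z' n|, by
    simpa using (LocallyConvexVectorLattice.tendsto_abs_zero hz).add
      (LocallyConvexVectorLattice.tendsto_abs_zero hz'), fun n => ?_⟩
  rw [(hQ x y).2, inf_add]
  refine le_inf ?_ ?_
  · refine (hmono n _ _ inf_le_left).trans ((hxz n).trans (add_le_add_right ?_ _))
    exact (le_abs_self _).trans (le_add_of_nonneg_right (abs_nonneg _))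
  · refine (hmono n _ _ inf_le_right).trans ((hyz n).trans (add_le_add_right ?_ _))
    exact (le_abs_self _).trans (le_add_of_nonneg_left (abs_nonneg _))

/-- One-sided approximability of `h` and `-h` by elements of `asymptoticallyBelow R Q`, with an
error that is a small multiple of a fixed `u`, forces convergence at `h`. -/
theorem tendsto_of_approx_above {V : Type*} [AddCommGroup V] [Lattice V]
    [IsOrderedAddMonoid V] [Module ℝ V]
    {R : ℕ → V →ₗ[ℝ] F} {Q : V →ₗ[ℝ] F} (hR : ∀ n x, 0 ≤ x → 0 ≤ R n x)
    (hQ : ∀ x, 0 ≤ x → 0 ≤ Q x) {u h : V} (hu : 0 ≤ u)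
    (habove : ∀ ε : ℝ, 0 < ε → ∃ g ∈ asymptoticallyBelow R Q, h ≤ g ∧ g ≤ h + ε • u)
    (hbelow : ∀ ε : ℝ, 0 < ε → ∃ g ∈ asymptoticallyBelow R Q, -h ≤ g ∧ g ≤ -h + ε • u) :
    Tendsto (fun n => R n h) atTop (𝓝 (Q h)) := by
  have hbound : ∀ (ε : ℝ) (k g : V), g ∈ asymptoticallyBelow R Q → k ≤ g → g ≤ k + ε • u →
      ∃ z : ℕ → F, Tendsto z atTop (𝓝 0) ∧ ∀ n, R n k - Q k ≤ ε • Q u + |z n| := by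
    rintro ε k g ⟨z, hz, hgz⟩ hkg hgk
    refine ⟨z, hz, fun n => ?_⟩
    have h1 : R n k ≤ R n g := by
      have h := hR n _ (sub_nonneg.2 hkg)
      rwa [map_sub, sub_nonneg] at h
    have h2 : Q g ≤ Q k + ε • Q u := by
      have h := hQ _ (sub_nonneg.2 hgk)
      rwa [map_sub, sub_nonneg, map_add, map_smul] at h
    rw [sub_le_iff_le_add']
    calc R n k ≤ Q g + z n := h1.trans (hgz n)
      _ ≤ (Q k + ε • Q u) + |z n| := add_le_add h2 (le_abs_self _)
      _ = Q k + (ε • Q u + |z n|) := add_assoc _ _ _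
  suffices H : Tendsto (fun n => R n h - Q h) atTop (𝓝 0) by simpa using H.add_const (Q h)
  rw [LocallyConvexVectorLattice.solid_basis.tendsto_right_iff]
  rintro U ⟨hU, hsolid⟩
  have h1 : Tendsto (fun p : ℝ × F => p.1 • Q u + p.2) (𝓝[>] 0 ×ˢ 𝓝 0) (𝓝 0) := by
    have h2 : Continuous fun p : ℝ × F => p.1 • Q u + p.2 := by fun_prop
    have h3 := h2.tendsto (0, 0)
    rw [nhds_prod_eq, zero_smul, add_zero] at h3
    exact h3.mono_left (prod_mono nhdsWithin_le_nhds le_rfl)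
  obtain ⟨pa, hpa, pb, hpb, hp⟩ := eventually_prod_iff.1 (h1.eventually hU)
  obtain ⟨ε, hεa, hε⟩ := (hpa.and self_mem_nhdsWithin).exists
  have hε : 0 < ε := hε
  obtain ⟨g, hg, hhg, hgh⟩ := habove ε hε
  obtain ⟨g', hg', hhg', hgh'⟩ := hbelow ε hε
  obtain ⟨z, hz, hzb⟩ := hbound ε h g hg hhg hgh
  obtain ⟨z', hz', hzb'⟩ := hbound ε (-h) g' hg' hhg' hgh'
  have h2 : Tendsto (fun n => |z n| + |z' n|) atTop (𝓝 0) := by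
    simpa using (LocallyConvexVectorLattice.tendsto_abs_zero hz).add
      (LocallyConvexVectorLattice.tendsto_abs_zero hz')
  filter_upwards [h2.eventually hpb] with n hn
  refine hsolid (hp hεa hn) ?_
  have h0 : 0 ≤ ε • Q u := smul_nonneg hε.le (hQ u hu)
  have hz0 := abs_nonneg (z n)
  have hz0' := abs_nonneg (z' n)
  rw [abs_of_nonneg (add_nonneg h0 (add_nonneg hz0 hz0'))]
  refine abs_le'.2 ⟨(hzb n).trans (add_le_add_right (le_add_of_nonneg_right hz0') _), ?_⟩
  have h3 := hzb' n
  rw [map_neg, map_neg, neg_sub_neg, ← neg_sub] at h3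
  exact h3.trans (add_le_add_right (le_add_of_nonneg_left hz0) _)

/-- If `R n → Q` at `1`, `f i` and `(f i) ^ 2`, then `R n → Q` at every function that is constant
on the common fibres of the `f i`. -/
theorem tendsto_of_mem_fibreConstant {R : ℕ → C(X, ℝ) →ₗ[ℝ] F} {Q : C(X, ℝ) →ₗ[ℝ] F}
    (hR : ∀ n x, 0 ≤ x → 0 ≤ R n x) (hQ : IsVectorLatticeHom Q) {f : ι → C(X, ℝ)}
    (h1 : 1 ∈ convergenceSubmodule R Q) (hf : ∀ i, f i ∈ convergenceSubmodule R Q)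
    (hf2 : ∀ i, f i ^ 2 ∈ convergenceSubmodule R Q) {h : C(X, ℝ)} (hh : h ∈ fibreConstant f) :
    Tendsto (fun n => R n h) atTop (𝓝 (Q h)) := by
  have key : ∀ k ∈ fibreConstant f, ∀ ε : ℝ, 0 < ε →
      ∃ g ∈ asymptoticallyBelow R Q, k ≤ g ∧ g ≤ k + ε • 1 := fun k hk ε hε =>
    exists_inf_majorant hk (convergenceSubmodule R Q) h1 hf hf2 _
      (convergenceSubmodule_subset_asymptoticallyBelow R Q)
      (fun g hg g' hg' => asymptoticallyBelow_inf_mem hR hQ hg hg') hε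
  exact tendsto_of_approx_above hR hQ.nonneg zero_le_one (key h hh) (key (-h) (neg_mem hh))

end Korovkin

/-! ### Test sets -/

section TestSet

variable {E : Type u} [AddCommGroup E] [Lattice E] [Module ℝ E] [UniformSpace E]
  [LocallyConvexVectorLattice E]

/-- The functions constant on the common fibres of the `T⁻¹ (a i)` form a vector sublattice of
`C(X)`, and its image is dense since it contains the generating system. The functions `T⁻¹ (a i)`
need not separate the points of `X`, so this image may be smaller than `E_e`. -/
theorem isConvergenceTestSet_of_latticeIso {e : E} {ι : Type t} {a : ι → E}
    (ha : IsGeneratingSystem (Set.range a)) (hae : ∀ i, a i ∈ principalIdeal e)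
    {X : Type v} [TopologicalSpace X] [CompactSpace X] (T : C(X, ℝ) ≃ₗ[ℝ] principalIdeal e)
    (hT : IsLatticeIsoOntoIdeal T) (hT1 : (T 1 : E) = e) :
    IsConvergenceTestSet.{u, w} ({e} ∪ Set.range a ∪
      Set.range (fun i => (T ((T.symm ⟨a i, hae i⟩) ^ 2) : E))) := by
  intro F _ _ _ _ _ P Tn hPc hP hTn heq hconv
  let S : C(X, ℝ) →ₗ[ℝ] E := (principalIdeal e).subtype ∘ₗ T.toLinearMap
  let f : ι → C(X, ℝ) := fun i => T.symm ⟨a i, hae i⟩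
  have hS : ∀ g, S g = T g := fun g => rfl
  have hSf : ∀ i, S (f i) = a i := fun i => by
    rw [hS, LinearEquiv.apply_symm_apply]
  have hSlat : IsVectorLatticeHom S := hT
  have hlim : ∀ g ∈ fibreConstant f, Tendsto (fun n => Tn n (S g)) atTop (𝓝 (P (S g))) := by
    refine fun g hg => tendsto_of_mem_fibreConstant (R := fun n => Tn n ∘ₗ S) (Q := P ∘ₗ S)
      (fun n x hx => hTn n _ (hSlat.nonneg x hx)) ?_ ?_ ?_ ?_ hg
    · intro x y
      simp only [LinearMap.comp_apply, (hSlat x y).1, (hSlat x y).2, (hP _ _).1, (hP _ _).2,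
        and_self]
    · rw [mem_convergenceSubmodule]
      exact hconv _ (Or.inl (Or.inl hT1))
    · intro i
      rw [mem_convergenceSubmodule]
      exact hconv _ (Or.inl (Or.inr ⟨i, (hSf i).symm⟩))
    · intro i
      rw [mem_convergenceSubmodule]
      exact hconv _ (Or.inr ⟨i, rfl⟩)
  have hdense : Dense (((fibreConstant f).map S : Submodule ℝ E) : Set E) := by
    refine ha.dense _ ?_ ?_
    · rintro _ ⟨g, hg, rfl⟩ _ ⟨g', hg', rfl⟩
      refine ⟨⟨g ⊔ g', fun x y hxy => ?_, (hSlat g g').1⟩,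
        ⟨g ⊓ g', fun x y hxy => ?_, (hSlat g g').2⟩⟩
      · exact congrArg₂ (· ⊔ ·) (hg x y hxy) (hg' x y hxy)
      · exact congrArg₂ (· ⊓ ·) (hg x y hxy) (hg' x y hxy)
    · rintro _ ⟨i, rfl⟩
      exact ⟨f i, fun x y hxy => hxy i, hSf i⟩
  have hclosed : IsClosed {x | Tendsto (fun n => Tn n x) atTop (𝓝 (P x))} :=
    heq.isClosed_setOfPred_tendsto hPc
  intro x
  refine hclosed.closure_subset_iff.2 ?_ (hdense x)
  rintro _ ⟨g, hg, rfl⟩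
  exact hlim g hg

/-- The sum of the absolute values of finitely many generators dominates all of them, so it can
serve as the unit. -/
theorem exists_finite_isConvergenceTestSet [T2Space E] (hE : IsSequentiallyComplete E)
    (A : Finset E) (hA : IsGeneratingSystem (A : Set E)) :
    ∃ S : Finset E, S.card ≤ 2 * A.card + 1 ∧ IsConvergenceTestSet.{u, w} (S : Set E) := by
  classical
  let e : E := ∑ x ∈ A, |x|
  have he : 0 ≤ e := Finset.sum_nonneg fun x _ => abs_nonneg x
  have hae : ∀ i : A, (i : E) ∈ principalIdeal e := fun i =>
    ⟨1, by
      rw [one_nsmul]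
      exact Finset.single_le_sum (f := fun x : E => |x|) (fun x _ => abs_nonneg x) i.2⟩
  obtain ⟨X, _, _, _, T, hT, hT1⟩ := exists_latticeIso_principalIdeal hE he
  have ha : IsGeneratingSystem (Set.range fun i : A => (i : E)) := by
    rwa [Subtype.range_coe_subtype]
  have htest := isConvergenceTestSet_of_latticeIso.{u, u, w, u} ha hae T hT hT1
  let sq : A → E := fun i => (T ((T.symm ⟨(i : E), hae i⟩) ^ 2) : E)
  refine ⟨insert e (A ∪ Finset.univ.image sq), ?_, ?_⟩
  · have h1 := Finset.card_insert_le e (A ∪ Finset.univ.image sq)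
    have h2 := Finset.card_union_le A (Finset.univ.image sq)
    have h3 : (Finset.univ.image sq).card ≤ A.card :=
      Finset.card_image_le.trans (by simp)
    lia
  · convert htest using 1
    ext x
    simp [sq, or_assoc]

end TestSet

theorem theorem7 {E : Type u} [AddCommGroup E] [Lattice E] [Module ℝ E] [UniformSpace E]
    [T2Space E] [LocallyConvexVectorLattice E] (hE : IsSequentiallyComplete E)
    (e : E) (he : IsQuasiInteriorPoint e)
    {ι : Type t} (a : ι → E) (ha : IsGeneratingSystem (Set.range a))
    (hae : ∀ i, a i ∈ principalIdeal e) :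
    -- (i)
    (∃ (X : Type u) (_ : TopologicalSpace X) (_ : CompactSpace X) (_ : T2Space X)
      (T : C(X, ℝ) ≃ₗ[ℝ] principalIdeal e),
      IsLatticeIsoOntoIdeal T ∧ (T 1 : E) = e) ∧
    -- (ii)
    (∀ (X : Type v) [TopologicalSpace X] [CompactSpace X]
      (T : C(X, ℝ) ≃ₗ[ℝ] principalIdeal e),
      IsLatticeIsoOntoIdeal T → (T 1 : E) = e →
      IsConvergenceTestSet.{u, w} ({e} ∪ Set.range a ∪
        Set.range (fun i => (T ((T.symm ⟨a i, hae i⟩) ^ 2) : E)))) ∧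
    -- (iii)
    (∀ (k : ℕ) (A : Finset E), A.card = k → IsGeneratingSystem (A : Set E) →
      ∃ S : Finset E, S.card ≤ 2 * k + 1 ∧ IsConvergenceTestSet.{u, w} (S : Set E)) := by
  refine ⟨exists_latticeIso_principalIdeal hE he.1, fun X _ _ T hT hT1 =>
    isConvergenceTestSet_of_latticeIso ha hae T hT hT1, ?_⟩
  rintro k A rfl hA
  exact exists_finite_isConvergenceTestSet hE A hA
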